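/- Let $N\ge 1$ and $d\ge 1$ be integers. For $x=(x_1,\dots,x_N)\in(\mathbb{R}^d)^N$ let $c(x)=\sum_{1\le i<j\le N}\frac1{|x_i-x_j|}\in[0,+\infty]$ (with $1/0=+\infty$). For a Borel probability measure $\rho$ on $\mathbb{R}^d$ let $$C(\rho)=\inf\Big\{\int c\,dP\ :\ P \text{ a probability on } (\mathbb{R}^d)^N \text{ all of whose } N \text{ marginals are equal to } \rho\Big\},$$ and for a finite nonnegative Borel measure $\rho$ on $\mathbb{R}^d$, with mass $\|\rho\|$, let $$\overline C(\rho)=\inf\Big\{\liminf_{n} C(\rho_n)\ :\ \rho_n \text{ probabilities},\ \rho_n\stackrel{*}{\rightharpoonup}\rho\Big\},$$ where $\stackrel{*}{\rightharpoonup}$ is weak* convergence in duality with $C_0=C_0(\mathbb{R}^d)$ (so $\overline C(\rho)=+\infty$ if $\|\rho\|>1$). Let $C_0\oplus\mathbb{R}$ be the space of functions $\psi=\varphi+\kappa$ with $\varphi\in C_0$, $\kappa\in\mathbb{R}$, put $\psi_\infty=\kappa$, and let $\mathcal A$ be the set of $\psi\in C_0\oplus\mathbb{R}$ such that $\frac1N\sum_{i=1}^N\psi(x_i)\le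 c(x)$ for all $x\in(\mathbb{R}^d)^N$. An optimal potential for $\rho$ is a maximizer of $$\psi\mapsto\int\psi\,d\rho+(1-\|\rho\|)\,\psi_\infty\qquad\text{over }\psi\in\mathcal A.$$ **Theorem.** For every $N\ge1$ there is a function $\gamma:[0,\infty)\times[0,\infty)\to[0,\infty)$, depending only on $N$, such that the following holds for every $d\ge1$, every finite nonnegative Borel measure $\rho$ on $\mathbb{R}^d$ with $\|\rho\|<1$, and all $\delta>0$ and $K\ge 0$ with $\overline C((1+\delta)\rho)\le K<+\infty$. 1. There is an optimal potential $u\in C_0\oplus\mathbb{R}$ for $\rho$ which is Lipschitz with constant $\gamma(\delta,K)$, and $\int u\,d\rho+(1-\|\rho\|)u_\infty=\overline C(\rho)$. 2. For every optimal potential $v\in C_0\oplus\mathbb{R}$ for $\rho$ there is an optimal potential $w\in C_0\oplus\mathbb{R}$ which is Lipschitz with constant $\gamma(\delta,K)$ and satisfies $v=w$ on $\operatorname{spt}\rho$. -/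

import Mathlib

open MeasureTheory Filter Topology
open scoped NNReal ENNReal ZeroAtInfty

noncomputable section

namespace RelaxedCoulomb

/-- The Euclidean space `ℝ^d`. -/
abbrev Space (d : ℕ) : Type := EuclideanSpace ℝ (Fin d)

/-- The Coulomb interaction `c(x₁, …, x_N) = ∑_{i < j} 1 / |x_i - x_j|` with values in `[0, ∞]`;
it is `∞` as soon as two of the points coincide (in `[0, ∞]` one has `0⁻¹ = ∞`). -/
def coulomb {d N : ℕ} (x : Fin N → Space d) : ℝ≥0∞ :=
  ∑ i, ∑ j ∈ Finset.Ioi i, (edist (x i) (x j))⁻¹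

/-- The multi-marginal transport plans with all `N` marginals equal to `ρ`. -/
def plans {d : ℕ} (N : ℕ) (ρ : ProbabilityMeasure (Space d)) :
    Set (ProbabilityMeasure (Fin N → Space d)) :=
  {P | ∀ i : Fin N, (P : Measure (Fin N → Space d)).map (fun x => x i) = (ρ : Measure (Space d))}

/-- The multi-marginal transport cost `C(ρ)` of a probability measure. -/
def transportCost {d : ℕ} (N : ℕ) (ρ : ProbabilityMeasure (Space d)) : ℝ≥0∞ :=
  ⨅ P ∈ plans N ρ, ∫⁻ x, coulomb x ∂(P : Measure (Fin N → Space d))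

/-- Weak* convergence of a sequence of probability measures to a finite measure, in duality with
the continuous functions vanishing at infinity (mass may be lost at infinity). -/
def WeakStarTendsto {d : ℕ} (ρs : ℕ → ProbabilityMeasure (Space d))
    (ρ : FiniteMeasure (Space d)) : Prop :=
  ∀ φ : C₀(Space d, ℝ),
    Tendsto (fun n => ∫ x, φ x ∂(ρs n : Measure (Space d))) atTop
      (𝓝 (∫ x, φ x ∂(ρ : Measure (Space d))))

/-- The relaxed cost: the infimum of `liminf_n C(ρ_n)` over all sequences of probability measures
converging weakly* to `ρ`. It is `∞` when there is no such sequence, that is, when `‖ρ‖ > 1`. -/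
def relaxedCost {d : ℕ} (N : ℕ) (ρ : FiniteMeasure (Space d)) : ℝ≥0∞ :=
  ⨅ (ρs : ℕ → ProbabilityMeasure (Space d)) (_ : WeakStarTendsto ρs ρ),
    liminf (fun n => transportCost N (ρs n)) atTop

/-- The space `C₀ ⊕ ℝ`: the pair `(φ, κ)` stands for the function `φ + κ`,
whose limit at infinity is `κ`. -/
abbrev Potential (d : ℕ) : Type := C₀(Space d, ℝ) × ℝ

/-- The function `ψ = φ + κ` on `ℝ^d` given by an element of `C₀ ⊕ ℝ`. -/
def Potential.eval {d : ℕ} (ψ : Potential d) (x : Space d) : ℝ := ψ.1 x + ψ.2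

/-- The value `ψ_∞` of `ψ` at infinity. -/
def Potential.atInfinity {d : ℕ} (ψ : Potential d) : ℝ := ψ.2

/-- The class of admissible potentials: `(1/N) ∑ ψ(x_i) ≤ c(x)` for all `x ∈ (ℝ^d)^N`. -/
def admissible (d N : ℕ) : Set (Potential d) :=
  {ψ | ∀ x : Fin N → Space d,
    (((1 / (N : ℝ)) * ∑ i, Potential.eval ψ (x i) : ℝ) : EReal) ≤ (coulomb x : EReal)}

/-- The dual objective `∫ ψ dρ + (1 - ‖ρ‖) ψ_∞`. -/
def dualValue {d : ℕ} (ρ : FiniteMeasure (Space d)) (ψ : Potential d) : ℝ :=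
  ∫ x, Potential.eval ψ x ∂(ρ : Measure (Space d))
    + (1 - (ρ.mass : ℝ)) * Potential.atInfinity ψ

/-- `ψ` is an optimal potential: it is admissible and maximizes the dual objective among all
admissible potentials. -/
def IsOptimalPotential {d : ℕ} (N : ℕ) (ρ : FiniteMeasure (Space d)) (ψ : Potential d) : Prop :=
  ψ ∈ admissible d N ∧ IsMaxOn (dualValue ρ) (admissible d N) ψ

end RelaxedCoulomb

end

/-! The proof replaces a potential by a maximal admissible function above it: maximality forces
regularity. If `g` is maximal, then through every point `x` there passes a configuration on which
the constraint is almost an equality, since otherwise `g` could be raised at `x` alone. Moving `x`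
to `z` in that configuration bounds `g z - g x` by `N` times a difference of Coulomb terms. An upper
bound on `g` bounds the energy of the configuration, so its points are separated and the difference
is Lipschitz. Letting `z` go to infinity instead shows that `g` tends to its infimum there, so `g`
lies in `C₀ ⊕ ℝ`. The upper bound comes from a lower bound `-A` at infinity: the other `N - 1`
points are sent far away, where their interaction vanishes.

The constant `A` comes from weak duality at `(1 + δ)ρ`. With `I = ∫ φ dρ`, every admissible `φ + κ`
satisfies `(1 + δ) I + κ ≤ K`; if its dual value `I + κ` is nonnegative, then `I ≤ K / δ` and `κ ≥
-K / δ`. Raising a potential never lowers its dual value, so a regularized maximizing sequence has a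
pointwise limit, which is regularized once more to give an optimizer. Raising an optimal potential
leaves its integral unchanged, so nothing moves on the support.

Equality with the relaxed cost is a Hahn–Banach argument: a functional separating `(ρ, a)` from the
convex set of pairs (measure, cost bound) rescales to an admissible potential of dual value above
`a`. Separability of `C₀` turns membership in the weak closure into a sequence. -/

namespace RelaxedCoulomb

/-! ### Energy and admissibility on injective configurations -/

/-- The Coulomb energy as a real number; it is meaningful for injective configurations. -/
noncomputable def energy {d N : ℕ} (x : Fin N → Space d) : ℝ :=
  (1 / 2) * ∑ i, ∑ j, (dist (x i) (x j))⁻¹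

theorem sum_sum_eq_two_mul_sum_Ioi {N : ℕ} (f : Fin N → Fin N → ℝ) (hs : ∀ i j, f i j = f j i)
    (hd : ∀ i, f i i = 0) : ∑ i, ∑ j, f i j = 2 * ∑ i, ∑ j ∈ Finset.Ioi i, f i j := by
  have h1 : ∀ i, ∑ j, f i j = ∑ j ∈ Finset.Ioi i, f i j + ∑ j ∈ Finset.Iio i, f i j := by
    intro i
    have : (Finset.univ : Finset (Fin N)) = insert i (Finset.Ioi i ∪ Finset.Iio i) := by
      ext j
      simp only [Finset.mem_univ, Finset.mem_insert, Finset.mem_union, Finset.mem_Ioi,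
        Finset.mem_Iio, true_iff]
      rcases lt_trichotomy i j with h | h | h
      · exact Or.inr (Or.inl h)
      · exact Or.inl h.symm
      · exact Or.inr (Or.inr h)
    rw [this, Finset.sum_insert (by simp), hd, zero_add, Finset.sum_union]
    rw [Finset.disjoint_left]
    intro j hj hj'
    exact lt_asymm (Finset.mem_Ioi.1 hj) (Finset.mem_Iio.1 hj')
  have h2 : ∑ i, ∑ j ∈ Finset.Iio i, f i j = ∑ i, ∑ j ∈ Finset.Ioi i, f i j := by
    rw [Finset.sum_comm' (t' := Finset.univ) (s' := fun j => Finset.Ioi j) (by simp)]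
    exact Finset.sum_congr rfl fun i _ => Finset.sum_congr rfl fun j _ => hs _ _
  rw [Finset.sum_congr rfl fun i _ => h1 i, Finset.sum_add_distrib, h2]
  ring

theorem energy_eq {d N : ℕ} (x : Fin N → Space d) :
    energy x = ∑ i, ∑ j ∈ Finset.Ioi i, (dist (x i) (x j))⁻¹ := by
  rw [energy, sum_sum_eq_two_mul_sum_Ioi]
  · ring
  · intro i j; rw [dist_comm]
  · simp

theorem energy_nonneg {d N : ℕ} (x : Fin N → Space d) : 0 ≤ energy x := by
  unfold energy; positivity

theorem energy_comp_equiv {d N : ℕ} (x : Fin N → Space d) (σ : Equiv.Perm (Fin N)) :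
    energy (x ∘ σ) = energy x := by
  unfold energy
  congr 1
  simp only [Function.comp]
  rw [← Equiv.sum_comp σ (fun i => ∑ j, (dist (x i) (x j))⁻¹)]
  refine Finset.sum_congr rfl fun i _ => ?_
  exact Equiv.sum_comp σ (fun j => (dist (x (σ i)) (x j))⁻¹)

theorem coulomb_of_injective {d N : ℕ} {x : Fin N → Space d} (hx : Function.Injective x) :
    coulomb x = ENNReal.ofReal (energy x) := by
  rw [energy_eq, coulomb, ENNReal.ofReal_sum_of_nonneg (fun i _ => by positivity)]
  refine Finset.sum_congr rfl fun i _ => ?_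
  rw [ENNReal.ofReal_sum_of_nonneg (fun i _ => by positivity)]
  refine Finset.sum_congr rfl fun j hj => ?_
  have hij : x i ≠ x j := fun h => (Finset.mem_Ioi.1 hj).ne (hx h)
  rw [edist_dist, ENNReal.ofReal_inv_of_pos (dist_pos.2 hij)]

theorem coulomb_of_not_injective {d N : ℕ} {x : Fin N → Space d}
    (hx : ¬ Function.Injective x) : coulomb x = ⊤ := by
  have key : ∀ i j : Fin N, i < j → x i = x j → coulomb x = ⊤ := by
    intro i j hlt h
    rw [coulomb, ENNReal.sum_eq_top]
    refine ⟨i, Finset.mem_univ _, ?_⟩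
    rw [ENNReal.sum_eq_top]
    exact ⟨j, Finset.mem_Ioi.2 hlt, by simp [h]⟩
  simp only [Function.Injective, not_forall] at hx
  obtain ⟨i, j, h, hij⟩ := hx
  rcases lt_or_gt_of_ne hij with hlt | hlt
  · exact key i j hlt h
  · exact key j i hlt h.symm

/-- Admissibility of a real function, expressed on injective configurations. -/
def IsAdmissible {d : ℕ} (N : ℕ) (f : Space d → ℝ) : Prop :=
  ∀ x : Fin N → Space d, Function.Injective x → ∑ i, f (x i) ≤ N * energy x

/-- Colliding configurations have infinite cost and impose no constraint, so the extended-real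
inequality reduces to a real one. -/
theorem mem_admissible_iff {d N : ℕ} (hN : 1 ≤ N) {ψ : Potential d} :
    ψ ∈ admissible d N ↔ IsAdmissible N ψ.eval := by
  have hN' : (0 : ℝ) < N := by exact_mod_cast hN
  have aux : ∀ x : Fin N → Space d, Function.Injective x →
      ((((1 / (N : ℝ)) * ∑ i, Potential.eval ψ (x i) : ℝ) : EReal) ≤ (coulomb x : EReal) ↔
        ∑ i, ψ.eval (x i) ≤ N * energy x) := by
    intro x hx
    rw [coulomb_of_injective hx, EReal.coe_ennreal_ofReal, max_eq_left (energy_nonneg x),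
      EReal.coe_le_coe_iff, one_div, inv_mul_le_iff₀ hN']
  constructor
  · intro h x hx
    exact (aux x hx).1 (h x)
  · intro h x
    by_cases hx : Function.Injective x
    · exact (aux x hx).2 (h x hx)
    · rw [coulomb_of_not_injective hx]
      simp

theorem energy_update {d N : ℕ} (y : Fin N → Space d) (i : Fin N) (z : Space d) :
    energy (Function.update y i z) - energy y
      = ∑ j ∈ Finset.univ.erase i, ((dist z (y j))⁻¹ - (dist (y i) (y j))⁻¹) := by
  have key : ∀ x : Fin N → Space d, energy x =
      ∑ j ∈ Finset.univ.erase i, (dist (x i) (x j))⁻¹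
        + (1 / 2) * ∑ k ∈ Finset.univ.erase i, ∑ j ∈ Finset.univ.erase i,
            (dist (x k) (x j))⁻¹ := by
    intro x
    have hj : ∀ k, ∑ j, (dist (x k) (x j))⁻¹
        = (dist (x k) (x i))⁻¹ + ∑ j ∈ Finset.univ.erase i, (dist (x k) (x j))⁻¹ := fun k =>
      (Finset.add_sum_erase _ _ (Finset.mem_univ i)).symm
    rw [energy, ← Finset.add_sum_erase _ _ (Finset.mem_univ i), hj i,
      Finset.sum_congr rfl fun k _ => hj k, Finset.sum_add_distrib]
    have hs : ∑ k ∈ Finset.univ.erase i, (dist (x k) (x i))⁻¹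
        = ∑ k ∈ Finset.univ.erase i, (dist (x i) (x k))⁻¹ :=
      Finset.sum_congr rfl fun k _ => by rw [dist_comm]
    rw [hs]
    simp only [dist_self, inv_zero]
    ring
  have h1 : ∀ j ∈ Finset.univ.erase i, Function.update y i z j = y j := fun j hj =>
    Function.update_of_ne (Finset.ne_of_mem_erase hj) _ _
  rw [key, key y, Finset.sum_sub_distrib, Function.update_self,
    Finset.sum_congr rfl fun j hj => by rw [h1 j hj]]
  have h2 : ∑ k ∈ Finset.univ.erase i, ∑ j ∈ Finset.univ.erase i,
      (dist (Function.update y i z k) (Function.update y i z j))⁻¹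
      = ∑ k ∈ Finset.univ.erase i, ∑ j ∈ Finset.univ.erase i, (dist (y k) (y j))⁻¹ :=
    Finset.sum_congr rfl fun k hk => Finset.sum_congr rfl fun j hj => by rw [h1 j hj, h1 k hk]
  rw [h2]
  ring

theorem inv_dist_le_energy {d N : ℕ} (x : Fin N → Space d) {i j : Fin N} (hij : i ≠ j) :
    (dist (x i) (x j))⁻¹ ≤ energy x := by
  have key : ∀ i j : Fin N, i < j → (dist (x i) (x j))⁻¹ ≤ energy x := by
    intro i j h
    rw [energy_eq]
    refine le_trans ?_ (Finset.single_le_sum (f := fun i => ∑ j ∈ Finset.Ioi i,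
      (dist (x i) (x j))⁻¹) (fun i _ => by positivity) (Finset.mem_univ i))
    exact Finset.single_le_sum (f := fun j => (dist (x i) (x j))⁻¹)
      (fun i _ => by positivity) (Finset.mem_Ioi.2 h)
  rcases lt_or_gt_of_ne hij with h | h
  · exact key i j h
  · rw [dist_comm]; exact key j i h

theorem energy_le_of_separated {d N : ℕ} (x : Fin N → Space d) {R : ℝ} (hR : 0 < R)
    (h : ∀ i j, i ≠ j → R ≤ dist (x i) (x j)) : energy x ≤ N * N / R := by
  have h1 : ∑ i, ∑ j, (dist (x i) (x j))⁻¹ ≤ ∑ _i : Fin N, ∑ _j : Fin N, R⁻¹ := by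
    refine Finset.sum_le_sum fun i _ => Finset.sum_le_sum fun j _ => ?_
    by_cases hij : i = j
    · simp [hij, hR.le]
    · exact inv_anti₀ hR (h i j hij)
  simp only [Finset.sum_const, Finset.card_univ, Fintype.card_fin, nsmul_eq_mul] at h1
  have h2 : (0 : ℝ) ≤ N * (N * R⁻¹) := by positivity
  have h3 : (N : ℝ) * N / R = N * (N * R⁻¹) := by rw [div_eq_mul_inv]; ring
  rw [energy, h3]
  linarith

/-! ### Sending points to infinity -/

/-- If a property holds for points arbitrarily far away, then any point can be completed to a
configuration whose other points have the property and whose energy is arbitrarily small. -/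
theorem exists_spread_configuration {d N : ℕ} {p : Space d → Prop}
    (hp : ∃ᶠ z in cocompact (Space d), p z) (x : Space d) (i₀ : Fin N) {ε : ℝ} (hε : 0 < ε) :
    ∃ y : Fin N → Space d, Function.Injective y ∧ y i₀ = x ∧ (∀ i, i ≠ i₀ → p (y i)) ∧
      N * energy y ≤ ε := by
  have hN : (0 : ℝ) < N := by
    have : 0 < N := i₀.pos
    exact_mod_cast this
  -- Points at mutual distance at least `R` have energy at most `N * N / R`, and `N` times this is
  -- exactly `ε`.
  set R : ℝ := N * (N * N) / ε with hRdef
  have hR : 0 < R := by positivity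
  have hfar : ∀ x' : Space d, ∀ᶠ z in cocompact (Space d), R ≤ dist z x' := fun x' =>
    (tendsto_dist_right_cocompact_atTop x').eventually_ge_atTop R
  have : Std.Symm (fun a b : Space d => R ≤ dist a b) := ⟨fun a b h => by rwa [dist_comm]⟩
  obtain ⟨z, hz, hzz⟩ := exists_seq_of_forall_finset_exists' (fun z => p z ∧ R ≤ dist z x)
    (fun a b => R ≤ dist a b) (fun s _ => by
      have h1 : ∀ᶠ z in cocompact (Space d), ∀ x' ∈ s, R ≤ dist z x' :=
        (Filter.eventually_all_finset s).2 fun x' _ => hfar x'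
      obtain ⟨z, hz1, hz2, hz3⟩ := (hp.and_eventually ((hfar x).and h1)).exists
      exact ⟨z, ⟨hz1, hz2⟩, fun x' hx' => by rw [dist_comm]; exact hz3 x' hx'⟩)
  set y : Fin N → Space d := Function.update (fun i => z i) i₀ x with hy
  have hy0 : y i₀ = x := Function.update_self ..
  have hy1 : ∀ i, i ≠ i₀ → y i = z i := fun i hi => Function.update_of_ne hi _ _
  have hsep : ∀ i j, i ≠ j → R ≤ dist (y i) (y j) := by
    intro i j hij
    by_cases hi : i = i₀
    · subst hi
      rw [hy0, hy1 j (Ne.symm hij), dist_comm]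
      exact (hz j).2
    · by_cases hj : j = i₀
      · subst hj
        rw [hy0, hy1 i hi]
        exact (hz i).2
      · rw [hy1 i hi, hy1 j hj]
        exact hzz (fun h => hij (Fin.ext h))
  refine ⟨y, ?_, hy0, fun i hi => by rw [hy1 i hi]; exact (hz i).1, ?_⟩
  · intro i j h
    by_contra hij
    have := hsep i j hij
    rw [h, dist_self] at this
    linarith
  · calc N * energy y ≤ N * (N * N / R) :=
          mul_le_mul_of_nonneg_left (energy_le_of_separated y hR hsep) hN.le
      _ = ε := by rw [hRdef]; field_simp

/-- The other `N - 1` points can be taken far apart where `g` is at least `a`; their total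
interaction, including that with `x`, is negligible. -/
theorem IsAdmissible.le_of_frequently {d N : ℕ} (hN : 1 ≤ N) {g : Space d → ℝ}
    (hg : IsAdmissible N g) {a : ℝ} (ha : ∃ᶠ z in cocompact (Space d), a ≤ g z) (x : Space d) :
    g x ≤ -((N - 1) * a) := by
  refine le_of_forall_pos_le_add fun ε hε => ?_
  obtain ⟨y, hy, hy0, hya, hyE⟩ := exists_spread_configuration ha x (⟨0, hN⟩ : Fin N) hε
  have h1 := hg y hy
  rw [← Finset.add_sum_erase _ _ (Finset.mem_univ (⟨0, hN⟩ : Fin N)), hy0] at h1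
  have h2 := Finset.card_nsmul_le_sum (Finset.univ.erase (⟨0, hN⟩ : Fin N)) (fun i => g (y i)) a
    (fun i hi => hya i (Finset.ne_of_mem_erase hi))
  rw [Finset.card_erase_of_mem (Finset.mem_univ _), Finset.card_univ, Fintype.card_fin,
    nsmul_eq_mul, Nat.cast_sub hN, Nat.cast_one] at h2
  linarith

/-! ### Maximal admissible functions and their regularity -/

/-- Zorn's lemma applies because the lower bound at infinity, inherited by every larger function,
bounds a chain pointwise from above, so its supremum is finite. -/
theorem exists_maximal_isAdmissible {d N : ℕ} (hN : 1 ≤ N) {f : Space d → ℝ}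
    (hf : IsAdmissible N f) {a : ℝ} (ha : ∃ᶠ z in cocompact (Space d), a ≤ f z) :
    ∃ g, f ≤ g ∧ Maximal (IsAdmissible N) g := by
  have hbound : ∀ g, IsAdmissible N g → f ≤ g → ∀ x, g x ≤ -((N - 1) * a) := fun g hg hfg =>
    hg.le_of_frequently hN (ha.mono fun z hz => hz.trans (hfg z))
  obtain ⟨m, hfm, hm⟩ := zorn_le_nonempty₀ {g | IsAdmissible N g ∧ f ≤ g} (by
    intro c hc hchain y hyc
    have : Nonempty c := ⟨⟨y, hyc⟩⟩
    have hbdd : ∀ x, BddAbove (Set.range fun g : c => (g : Space d → ℝ) x) := by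
      rintro x
      refine ⟨-((N - 1) * a), ?_⟩
      rintro _ ⟨g, rfl⟩
      exact hbound g (hc g.2).1 (hc g.2).2 x
    have hle : ∀ z ∈ c, z ≤ fun x => ⨆ g : c, (g : Space d → ℝ) x := fun z hz x =>
      le_ciSup (hbdd x) ⟨z, hz⟩
    refine ⟨fun x => ⨆ g : c, (g : Space d → ℝ) x, ⟨?_, (hc hyc).2.trans (hle y hyc)⟩, hle⟩
    intro x hx
    refine le_of_forall_pos_le_add fun ε hε => ?_
    have hNpos : (0 : ℝ) < N := by exact_mod_cast hN
    have hex : ∀ i, ∃ g : c, (⨆ g : c, (g : Space d → ℝ) (x i)) - ε / N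
        < (g : Space d → ℝ) (x i) := fun i =>
      exists_lt_of_lt_ciSup (sub_lt_self _ (by positivity))
    choose G hG using hex
    -- The constraint involves only `N` values, so a single member of the chain nearly attains the
    -- supremum at all of them.
    have hdir : Directed (· ≤ ·) (fun g : c => (g : Space d → ℝ)) :=
      hchain.directedOn.directed_val
    obtain ⟨h, hh⟩ := hdir.finite_le G
    have h1 := (hc h.2).1 x hx
    have h2 : ∑ i, ((⨆ g : c, (g : Space d → ℝ) (x i)) - ε / N)
        ≤ ∑ i, (h : Space d → ℝ) (x i) :=
      Finset.sum_le_sum fun i _ => (hG i).le.trans (hh i (x i))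
    rw [Finset.sum_sub_distrib, Finset.sum_const, Finset.card_univ, Fintype.card_fin,
      nsmul_eq_mul, mul_div_cancel₀ _ hNpos.ne'] at h2
    linarith) f ⟨hf, le_rfl⟩
  exact ⟨m, hfm, hm.prop.1, fun g hg hmg => hm.le_of_ge ⟨hg, hfm.trans hmg⟩ hmg⟩

/-- Otherwise `g` could be raised by `ε` at the single point `x`. No continuity is required of
competitors, and an injective configuration visits `x` at most once. -/
theorem exists_near_optimal_of_maximal {d N : ℕ} {g : Space d → ℝ}
    (hg : Maximal (IsAdmissible N) g) (x : Space d) {ε : ℝ} (hε : 0 < ε) :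
    ∃ (y : Fin N → Space d) (i : Fin N), Function.Injective y ∧ y i = x ∧
      N * energy y < ∑ j, g (y j) + ε := by
  classical
  by_contra! hcon
  have hupd : IsAdmissible N (Function.update g x (g x + ε)) := by
    intro y hy
    by_cases hx : ∃ i, y i = x
    · obtain ⟨i, hi⟩ := hx
      have h1 := hcon y i hy hi
      rw [← Finset.add_sum_erase _ _ (Finset.mem_univ i), hi] at h1 ⊢
      rw [Function.update_self, Finset.sum_congr rfl fun j hj => Function.update_of_ne
        (fun h => Finset.ne_of_mem_erase hj (hy (h.trans hi.symm))) _ _]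
      linarith
    · push Not at hx
      rw [Finset.sum_congr rfl fun j _ => Function.update_of_ne (hx j) _ _]
      exact hg.prop y hy
  have h2 := hg.le_of_ge hupd (fun z => by
    by_cases hz : z = x
    · subst hz; rw [Function.update_self]; linarith
    · rw [Function.update_of_ne hz]) x
  rw [Function.update_self] at h2
  linarith

/-- Comparing the almost saturated constraint at `y` with the constraint after moving the `i`-th
point to `z` cancels all other values of `g` and all interactions not involving that point. -/
theorem IsAdmissible.sub_le_of_update {d N : ℕ} {g : Space d → ℝ} (hg : IsAdmissible N g)
    {y : Fin N → Space d} {i : Fin N} {z : Space d} {ε : ℝ} (hy : Function.Injective y)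
    (hE : N * energy y < ∑ j, g (y j) + ε) (hz : ∀ j, j ≠ i → z ≠ y j) :
    g z - g (y i) ≤ N * ∑ j ∈ Finset.univ.erase i,
      ((dist z (y j))⁻¹ - (dist (y i) (y j))⁻¹) + ε := by
  have hinj : Function.Injective (Function.update y i z) := by
    intro j k hjk
    by_cases hj : j = i
    · by_cases hk : k = i
      · rw [hj, hk]
      · rw [hj, Function.update_self, Function.update_of_ne hk] at hjk
        exact absurd hjk (hz k hk)
    · by_cases hk : k = i
      · rw [hk, Function.update_self, Function.update_of_ne hj] at hjk
        exact absurd hjk.symm (hz j hj)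
      · rw [Function.update_of_ne hk, Function.update_of_ne hj] at hjk
        exact hy hjk
  have h1 := hg _ hinj
  rw [← Finset.add_sum_erase _ _ (Finset.mem_univ i), Function.update_self,
    Finset.sum_congr rfl fun j hj => by
      rw [Function.update_of_ne (Finset.ne_of_mem_erase hj)]] at h1
  rw [← Finset.add_sum_erase _ _ (Finset.mem_univ i)] at hE
  have h2 := energy_update y i z
  rw [← h2]
  linarith

/-- When `x` is moved far away in an almost saturated configuration, its interaction with the other
points disappears. This makes the limit at infinity equal to the infimum. -/
theorem eventually_le_add_of_maximal {d N : ℕ} {g : Space d → ℝ}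
    (hg : Maximal (IsAdmissible N) g) (x : Space d) {ε : ℝ} (hε : 0 < ε) :
    ∀ᶠ z in cocompact (Space d), g z ≤ g x + ε := by
  obtain ⟨y, i, hy, hyi, hE⟩ := exists_near_optimal_of_maximal hg x (half_pos hε)
  have hlim : Tendsto (fun z => N * ∑ j ∈ Finset.univ.erase i, (dist z (y j))⁻¹)
      (cocompact (Space d)) (𝓝 (N * ∑ j ∈ Finset.univ.erase i, (0 : ℝ))) :=
    (tendsto_finsetSum _ fun j _ =>
      (tendsto_dist_right_cocompact_atTop (y j)).inv_tendsto_atTop).const_mul _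
  rw [Finset.sum_const_zero, mul_zero] at hlim
  have hfar : ∀ᶠ z in cocompact (Space d), ∀ j, z ≠ y j := eventually_all.2 fun j =>
    ((tendsto_dist_right_cocompact_atTop (y j)).eventually_gt_atTop 0).mono fun z hz =>
      dist_pos.1 hz
  filter_upwards [hlim.eventually_lt_const (half_pos hε), hfar] with z hz1 hz2
  have h1 := hg.prop.sub_le_of_update (i := i) hy hE fun j _ => hz2 j
  rw [hyi, Finset.sum_sub_distrib] at h1
  have h2 : 0 ≤ (N : ℝ) * ∑ j ∈ Finset.univ.erase i, (dist x (y j))⁻¹ := by positivity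
  linarith

/-- Almost saturated configurations have energy at most `M + 1`, hence pairwise distances at least
`1 / (M + 1)`. A move by half this distance avoids the singularity, so each of the at most `N`
changed terms is Lipschitz. -/
theorem sub_le_of_maximal_of_dist_le {d N : ℕ} (hN : 1 ≤ N) {g : Space d → ℝ}
    (hg : Maximal (IsAdmissible N) g) {M : ℝ} (hM : 0 ≤ M) (hgM : ∀ x, g x ≤ M)
    {x z : Space d} (hxz : dist z x ≤ 1 / (2 * (M + 1))) :
    g z - g x ≤ 2 * N ^ 2 * (M + 1) ^ 2 * dist z x := by
  have hN' : (1 : ℝ) ≤ N := by exact_mod_cast hN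
  refine le_of_forall_pos_le_add fun ε hε => ?_
  -- The cap at `1` keeps the energy bound independent of `ε`.
  obtain ⟨y, i, hy, hyi, hE⟩ := exists_near_optimal_of_maximal hg x (lt_min hε one_pos)
  have hEy : energy y ≤ M + 1 := by
    have h1 : ∑ j, g (y j) ≤ N * M := by
      refine (Finset.sum_le_card_nsmul _ _ M fun j _ => hgM _).trans ?_
      rw [Finset.card_univ, Fintype.card_fin, nsmul_eq_mul]
    have h2 : N * energy y ≤ N * (M + 1) := by
      have := min_le_right ε 1
      linarith
    exact le_of_mul_le_mul_left h2 (by linarith)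
  have hb : ∀ j, j ≠ i → 1 / (M + 1) ≤ dist x (y j) := by
    intro j hj
    have h1 := (inv_dist_le_energy y (Ne.symm hj)).trans hEy
    rw [hyi] at h1
    have hpos : 0 < dist x (y j) := dist_pos.2 fun h => hj (hy (by rw [hyi, h]))
    rw [one_div]
    exact inv_le_of_inv_le₀ hpos h1
  have hhalf : 1 / (M + 1) = 2 * (1 / (2 * (M + 1))) := by field_simp
  have ha : ∀ j, j ≠ i → 1 / (2 * (M + 1)) ≤ dist z (y j) := by
    intro j hj
    have h1 := hb j hj
    have h2 := dist_triangle x z (y j)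
    rw [dist_comm x z] at h2
    linarith
  have hr : 0 < 1 / (2 * (M + 1)) := by positivity
  have h1 := hg.prop.sub_le_of_update (i := i) (z := z) hy
    (hE.trans_le (add_le_add_right (min_le_left ε 1) _))
    fun j hj h => by
      have := ha j hj
      rw [h, dist_self] at this
      linarith
  rw [hyi] at h1
  have hterm : ∀ j ∈ Finset.univ.erase i, (dist z (y j))⁻¹ - (dist x (y j))⁻¹
      ≤ 2 * (M + 1) ^ 2 * dist z x := by
    intro j hj
    have hj' := Finset.ne_of_mem_erase hj
    have hap : 0 < dist z (y j) := hr.trans_le (ha j hj')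
    have hbp : 0 < dist x (y j) := lt_of_lt_of_le (by positivity) (hb j hj')
    rw [inv_sub_inv hap.ne' hbp.ne', div_le_iff₀ (mul_pos hap hbp)]
    have h3 : 1 / (2 * (M + 1)) * (1 / (M + 1)) ≤ dist z (y j) * dist x (y j) :=
      mul_le_mul (ha j hj') (hb j hj') (by positivity) hap.le
    have h4 : dist x (y j) - dist z (y j) ≤ dist z x := by
      have := dist_triangle x z (y j)
      rw [dist_comm x z] at this
      linarith
    calc dist x (y j) - dist z (y j) ≤ dist z x := h4
      _ = 2 * (M + 1) ^ 2 * dist z x * (1 / (2 * (M + 1)) * (1 / (M + 1))) := by field_simp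
      _ ≤ _ := mul_le_mul_of_nonneg_left h3 (by positivity)
  have h5 := Finset.sum_le_card_nsmul _ _ _ hterm
  rw [nsmul_eq_mul] at h5
  have h6 : ((Finset.univ.erase i).card : ℝ) ≤ N := by
    have := Finset.card_erase_le (s := (Finset.univ : Finset (Fin N))) (a := i)
    rw [Finset.card_univ, Fintype.card_fin] at this
    exact_mod_cast this
  have h7 : ((Finset.univ.erase i).card : ℝ) * (2 * (M + 1) ^ 2 * dist z x)
      ≤ N * (2 * (M + 1) ^ 2 * dist z x) := mul_le_mul_of_nonneg_right h6 (by positivity)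
  have h8 := mul_le_mul_of_nonneg_left (h5.trans h7) (by linarith : (0 : ℝ) ≤ N)
  nlinarith

/-- The Lipschitz constant of maximal admissible functions which are at least `-A` at infinity. -/
noncomputable def lipschitzBound (N : ℕ) (A : ℝ≥0) : ℝ≥0 := 2 * N ^ 2 * (N * A + 1) ^ 2

/-- Every admissible function which is at least `-A` at points arbitrarily far away lies below an
admissible potential that is Lipschitz with a constant depending only on `N` and `A`. -/
theorem exists_lipschitz_potential_ge {d N : ℕ} (hN : 1 ≤ N) {f : Space d → ℝ}
    (hf : IsAdmissible N f) {A : ℝ≥0} (hA : ∃ᶠ z in cocompact (Space d), -(A : ℝ) ≤ f z) :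
    ∃ w : Potential d, IsAdmissible N w.eval ∧ (∀ x, f x ≤ w.eval x) ∧
      LipschitzWith (lipschitzBound N A) w.eval ∧ -(A : ℝ) ≤ w.2 ∧ (∀ x, w.2 ≤ w.eval x) ∧
      ∀ x, w.eval x ≤ N * A := by
  have hN' : (1 : ℝ) ≤ N := by exact_mod_cast hN
  have hA0 : (0 : ℝ) ≤ A := A.2
  obtain ⟨g, hfg, hg⟩ := exists_maximal_isAdmissible hN hf hA
  have hgA : ∃ᶠ z in cocompact (Space d), -(A : ℝ) ≤ g z := hA.mono fun z hz => hz.trans (hfg z)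
  have hupper : ∀ x, g x ≤ N * A := fun x => by
    have := hg.prop.le_of_frequently hN hgA x
    linarith
  have hlower : ∀ x, -(A : ℝ) ≤ g x := fun x => by
    refine le_of_forall_pos_le_add fun ε hε => ?_
    obtain ⟨z, hz1, hz2⟩ := (hgA.and_eventually (eventually_le_add_of_maximal hg x hε)).exists
    linarith
  have hM : (0 : ℝ) ≤ N * A := by positivity
  have hLcoe : ((lipschitzBound N A : ℝ≥0) : ℝ) = 2 * N ^ 2 * (N * A + 1) ^ 2 := by
    simp [lipschitzBound]
  have hlip : LipschitzWith (lipschitzBound N A) g := by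
    refine LipschitzWith.of_le_add_mul _ fun z x => ?_
    rw [hLcoe]
    by_cases h : dist z x ≤ 1 / (2 * ((N : ℝ) * A + 1))
    · have := sub_le_of_maximal_of_dist_le hN hg hM hupper h
      linarith
    -- At larger distances the oscillation bound `(N - 1) * A + A = N * A` suffices.
    · push Not at h
      rw [div_lt_iff₀ (by positivity)] at h
      have h1 := hg.prop.le_of_frequently hN hgA z
      have h2 := hlower x
      have hsq : (1 : ℝ) ≤ (N : ℝ) ^ 2 := one_le_pow₀ hN'
      have h3 : g z - g x ≤ N * A := by linarith
      set M : ℝ := N * A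
      have h4 := mul_le_mul_of_nonneg_left h.le (by positivity : 0 ≤ M + 1)
      have h5 : 0 ≤ 2 * (M + 1) ^ 2 * dist z x := by positivity
      have h6 := mul_le_mul_of_nonneg_right hsq h5
      linarith
  have hbdd : BddBelow (Set.range g) := ⟨-A, by rintro _ ⟨x, rfl⟩; exact hlower x⟩
  set κ : ℝ := ⨅ x, g x with hκ
  have hκle : ∀ x, κ ≤ g x := fun x => ciInf_le hbdd x
  have hlim : Tendsto (fun x => g x - κ) (cocompact (Space d)) (𝓝 0) := by
    rw [Metric.tendsto_nhds]
    intro ε hε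
    obtain ⟨x, hx⟩ := exists_lt_of_ciInf_lt (lt_add_of_pos_right κ (half_pos hε))
    filter_upwards [eventually_le_add_of_maximal hg x (half_pos hε)] with z hz
    rw [Real.dist_eq, sub_zero, abs_of_nonneg (sub_nonneg.2 (hκle z))]
    linarith
  let w : Potential d := (⟨⟨fun x => g x - κ, hlip.continuous.sub continuous_const⟩, hlim⟩, κ)
  have hw : w.eval = g := funext fun x => sub_add_cancel _ _
  refine ⟨w, by rw [hw]; exact hg.prop, by rw [hw]; exact hfg, by rw [hw]; exact hlip,
    le_ciInf hlower, by rw [hw]; exact hκle, by rw [hw]; exact hupper⟩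

/-! ### Weak duality and the bounds it gives -/

theorem Potential.continuous_eval {d : ℕ} (ψ : Potential d) : Continuous ψ.eval :=
  (map_continuous ψ.1).add continuous_const

theorem Potential.tendsto_eval {d : ℕ} (ψ : Potential d) :
    Tendsto ψ.eval (cocompact (Space d)) (𝓝 ψ.2) := by
  have h := (zero_at_infty ψ.1).add_const ψ.2
  rwa [zero_add] at h

theorem integrable_zeroAtInfty {d : ℕ} (φ : C₀(Space d, ℝ)) (μ : Measure (Space d))
    [IsFiniteMeasure μ] : Integrable φ μ :=
  BoundedContinuousFunction.integrable μ φ.toBCF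

theorem Potential.integrable_eval {d : ℕ} (ψ : Potential d) (μ : Measure (Space d))
    [IsFiniteMeasure μ] : Integrable ψ.eval μ :=
  (integrable_zeroAtInfty ψ.1 μ).add (integrable_const _)

theorem dualValue_eq {d : ℕ} (ρ : FiniteMeasure (Space d)) (ψ : Potential d) :
    dualValue ρ ψ = ∫ x, ψ.1 x ∂(ρ : Measure (Space d)) + ψ.2 := by
  have h : ∫ x, ψ.eval x ∂(ρ : Measure (Space d))
      = ∫ x, ψ.1 x ∂(ρ : Measure (Space d)) + ρ.mass * ψ.2 := by
    unfold Potential.eval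
    rw [integral_add (integrable_zeroAtInfty _ _) (integrable_const _), integral_const,
      smul_eq_mul]
    rfl
  rw [dualValue, h, Potential.atInfinity]
  ring

/-- Integrating the constraint against a plan turns the average of the `N` coordinates into the
integral against the common marginal. -/
theorem ofReal_integral_le_lintegral_coulomb {d N : ℕ} (hN : 1 ≤ N)
    {ρ : ProbabilityMeasure (Space d)} {P : ProbabilityMeasure (Fin N → Space d)}
    (hP : P ∈ plans N ρ) {ψ : Potential d} (hψ : ψ ∈ admissible d N) :
    ENNReal.ofReal (∫ x, ψ.eval x ∂(ρ : Measure (Space d)))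
      ≤ ∫⁻ x, coulomb x ∂(P : Measure (Fin N → Space d)) := by
  have hN' : (N : ℝ) ≠ 0 := by exact_mod_cast (by omega : N ≠ 0)
  have hint : ∀ i, Integrable (fun x : Fin N → Space d => ψ.eval (x i))
      (P : Measure (Fin N → Space d)) := by
    intro i
    have := ψ.integrable_eval ((P : Measure (Fin N → Space d)).map fun x => x i)
    exact this.comp_measurable (measurable_pi_apply i)
  have hsum : ∫ x, (1 / (N : ℝ)) * ∑ i, ψ.eval (x i) ∂(P : Measure (Fin N → Space d))
      = ∫ x, ψ.eval x ∂(ρ : Measure (Space d)) := by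
    rw [integral_const_mul, integral_finsetSum _ fun i _ => hint i]
    have : ∀ i, ∫ x, ψ.eval (x i) ∂(P : Measure (Fin N → Space d))
        = ∫ x, ψ.eval x ∂(ρ : Measure (Space d)) := by
      intro i
      rw [← hP i, integral_map (measurable_pi_apply i).aemeasurable
        ψ.continuous_eval.aestronglyMeasurable]
    rw [Finset.sum_congr rfl fun i _ => this i, Finset.sum_const, Finset.card_univ,
      Fintype.card_fin, nsmul_eq_mul]
    field_simp
  rw [← hsum]
  have hint' : Integrable (fun x : Fin N → Space d => (1 / (N : ℝ)) * ∑ i, ψ.eval (x i))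
      (P : Measure (Fin N → Space d)) := (integrable_finsetSum _ fun i _ => hint i).const_mul _
  refine le_trans (b := ∫⁻ x, ENNReal.ofReal ((1 / (N : ℝ)) * ∑ i, ψ.eval (x i))
    ∂(P : Measure (Fin N → Space d))) ?_ (lintegral_mono fun x => ?_)
  · rw [integral_eq_lintegral_pos_part_sub_lintegral_neg_part hint']
    refine ENNReal.ofReal_le_of_le_toReal (sub_le_self _ ENNReal.toReal_nonneg)
  · have h := hψ x
    rw [← EReal.coe_ennreal_le_coe_ennreal_iff, EReal.coe_ennreal_ofReal]
    rcases max_choice ((1 / (N : ℝ)) * ∑ i, ψ.eval (x i)) 0 with h' | h' <;> rw [h']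
    · exact h
    · exact EReal.coe_ennreal_nonneg _

theorem ofReal_dualValue_le_relaxedCost {d N : ℕ} (hN : 1 ≤ N) (ρ : FiniteMeasure (Space d))
    {ψ : Potential d} (hψ : ψ ∈ admissible d N) :
    ENNReal.ofReal (dualValue ρ ψ) ≤ relaxedCost N ρ := by
  refine le_iInf₂ fun ρs hρs => ?_
  have h1 : Tendsto (fun n => ENNReal.ofReal (∫ x, ψ.eval x ∂(ρs n : Measure (Space d)))) atTop
      (𝓝 (ENNReal.ofReal (dualValue ρ ψ))) := by
    rw [dualValue_eq]
    refine (ENNReal.continuous_ofReal.tendsto _).comp (((hρs ψ.1).add_const ψ.2).congr fun n => ?_)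
    unfold Potential.eval
    rw [integral_add (integrable_zeroAtInfty _ _) (integrable_const _), integral_const]
    simp
  rw [← h1.liminf_eq]
  exact liminf_le_liminf (Eventually.of_forall fun n =>
    le_iInf₂ fun P hP => ofReal_integral_le_lintegral_coulomb hN hP hψ)

theorem one_add_mul_integral_add_le {d N : ℕ} (hN : 1 ≤ N) {ρ : FiniteMeasure (Space d)}
    {δ K : ℝ≥0} (hK : relaxedCost N ((1 + δ) • ρ) ≤ (K : ℝ≥0∞))
    {ψ : Potential d} (hψ : ψ ∈ admissible d N) :
    (1 + δ) * ∫ x, ψ.1 x ∂(ρ : Measure (Space d)) + ψ.2 ≤ K := by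
  have h := (ofReal_dualValue_le_relaxedCost hN ((1 + δ) • ρ) hψ).trans hK
  rw [dualValue_eq, FiniteMeasure.toMeasure_smul, integral_smul_nnreal_measure,
    ENNReal.ofReal_le_iff_le_toReal ENNReal.coe_ne_top] at h
  simpa [NNReal.smul_def] using h

/-- Weak duality at `(1 + δ)ρ` says that `δ` times `∫ φ dρ`, plus the dual value at `ρ`, is at most
`K`. This is where the room for extra mass is used. -/
theorem neg_div_le_of_dualValue_nonneg {d N : ℕ} (hN : 1 ≤ N) {ρ : FiniteMeasure (Space d)}
    {δ K : ℝ≥0} (hδ : 0 < δ) (hK : relaxedCost N ((1 + δ) • ρ) ≤ (K : ℝ≥0∞))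
    {ψ : Potential d} (hψ : ψ ∈ admissible d N) (h0 : 0 ≤ dualValue ρ ψ) :
    -(K / δ : ℝ) ≤ ψ.2 := by
  have h1 := one_add_mul_integral_add_le hN hK hψ
  rw [dualValue_eq] at h0
  have hδ' : (0 : ℝ) < δ := hδ
  set I := ∫ x, ψ.1 x ∂(ρ : Measure (Space d))
  have h2 : I ≤ K / δ := by rw [le_div_iff₀ hδ']; linarith
  linarith

theorem cocompact_neBot {d : ℕ} (hd : 1 ≤ d) : (cocompact (Space d)).NeBot := by
  have : Nonempty (Fin d) := ⟨⟨0, hd⟩⟩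
  infer_instance

/-- With a positive limit, `N` points far out and far apart would have a definitely positive sum but
arbitrarily small energy. -/
theorem atInfinity_nonpos {d N : ℕ} (hd : 1 ≤ d) (hN : 1 ≤ N) {ψ : Potential d}
    (hψ : ψ ∈ admissible d N) : ψ.2 ≤ 0 := by
  have := cocompact_neBot hd
  have hN' : (1 : ℝ) ≤ N := by exact_mod_cast hN
  by_contra! h
  have h1 : ∃ᶠ z in cocompact (Space d), ψ.2 / 2 ≤ ψ.eval z :=
    ((ψ.tendsto_eval.eventually_const_lt (half_lt_self h)).mono fun _ => le_of_lt).frequently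
  obtain ⟨z, hz⟩ := (ψ.tendsto_eval.eventually_const_lt h).exists
  have h2 := ((mem_admissible_iff hN).1 hψ).le_of_frequently hN h1 z
  have h3 : 0 ≤ ((N : ℝ) - 1) * (ψ.2 / 2) := mul_nonneg (by linarith) (by linarith)
  linarith

theorem dualValue_le_div {d N : ℕ} (hd : 1 ≤ d) (hN : 1 ≤ N) {ρ : FiniteMeasure (Space d)}
    {δ K : ℝ≥0} (hδ : 0 < δ) (hK : relaxedCost N ((1 + δ) • ρ) ≤ (K : ℝ≥0∞))
    {ψ : Potential d} (hψ : ψ ∈ admissible d N) : dualValue ρ ψ ≤ K / δ := by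
  by_cases h0 : 0 ≤ dualValue ρ ψ
  · have h1 := one_add_mul_integral_add_le hN hK hψ
    have h2 := atInfinity_nonpos hd hN hψ
    rw [dualValue_eq] at h0 ⊢
    have hδ' : (0 : ℝ) < δ := hδ
    set I := ∫ x, ψ.1 x ∂(ρ : Measure (Space d))
    have h3 : I ≤ K / δ := by rw [le_div_iff₀ hδ']; linarith
    linarith
  · exact (not_le.1 h0).le.trans (by positivity)

theorem zero_mem_admissible (d N : ℕ) : (0 : Potential d) ∈ admissible d N := by
  intro x
  simpa [Potential.eval] using EReal.coe_ennreal_nonneg (coulomb x)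

theorem dualValue_zero {d : ℕ} (ρ : FiniteMeasure (Space d)) : dualValue ρ 0 = 0 := by
  simp [dualValue_eq]

/-! ### Regularization of potentials -/

/-- The regularization of an admissible potential with nonnegative dual value. -/
theorem exists_lipschitz_potential_ge_of_dualValue_nonneg {d N : ℕ} (hd : 1 ≤ d) (hN : 1 ≤ N)
    {ρ : FiniteMeasure (Space d)} {δ K : ℝ≥0} (hδ : 0 < δ)
    (hK : relaxedCost N ((1 + δ) • ρ) ≤ (K : ℝ≥0∞))
    {ψ : Potential d} (hψ : ψ ∈ admissible d N) (h0 : 0 ≤ dualValue ρ ψ) :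
    ∃ w : Potential d, w ∈ admissible d N ∧ (∀ x, ψ.eval x ≤ w.eval x) ∧ ψ.2 ≤ w.2 ∧
      LipschitzWith (lipschitzBound N (K / δ + 1)) w.eval ∧
      -((K / δ + 1 : ℝ≥0) : ℝ) ≤ w.2 ∧ (∀ x, w.2 ≤ w.eval x) ∧
      ∀ x, w.eval x ≤ N * (K / δ + 1 : ℝ≥0) := by
  have := cocompact_neBot hd
  have h1 := neg_div_le_of_dualValue_nonneg hN hδ hK hψ h0
  -- The limit of `ψ` is at least `-K / δ`; the added `1` makes the inequality strict, so that it
  -- passes to the values of `ψ` near infinity.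
  have h2 : ∃ᶠ z in cocompact (Space d), -((K / δ + 1 : ℝ≥0) : ℝ) ≤ ψ.eval z := by
    refine Eventually.frequently ((ψ.tendsto_eval.eventually_const_lt
      (u := -((K / δ + 1 : ℝ≥0) : ℝ)) ?_).mono fun _ => le_of_lt)
    push_cast
    linarith
  obtain ⟨w, hw1, hw2, hw3, hw4, hw5, hw6⟩ :=
    exists_lipschitz_potential_ge hN ((mem_admissible_iff hN).1 hψ) h2
  exact ⟨w, (mem_admissible_iff hN).2 hw1, hw2,
    le_of_tendsto_of_tendsto' ψ.tendsto_eval w.tendsto_eval hw2, hw3, hw4, hw5, hw6⟩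

theorem dualValue_mono {d : ℕ} {ρ : FiniteMeasure (Space d)} (hρ : ρ.mass ≤ 1)
    {ψ w : Potential d} (h : ∀ x, ψ.eval x ≤ w.eval x) (h' : ψ.2 ≤ w.2) :
    dualValue ρ ψ ≤ dualValue ρ w := by
  have hρ' : (ρ.mass : ℝ) ≤ 1 := hρ
  exact add_le_add (integral_mono (ψ.integrable_eval _) (w.integrable_eval _) h)
    (mul_le_mul_of_nonneg_left h' (by linarith))

/-- Both terms of the dual value are monotone, so neither can increase. Equal integrals of ordered
functions give equality almost everywhere, and continuity extends it to the support. -/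
theorem eqOn_support_of_dualValue_le {d : ℕ} {ρ : FiniteMeasure (Space d)} (hρ : ρ.mass ≤ 1)
    {ψ w : Potential d} (h : ∀ x, ψ.eval x ≤ w.eval x) (h' : ψ.2 ≤ w.2)
    (hv : dualValue ρ w ≤ dualValue ρ ψ) :
    Set.EqOn ψ.eval w.eval (ρ : Measure (Space d)).support := by
  have hρ' : (ρ.mass : ℝ) ≤ 1 := hρ
  have h1 : ∫ x, w.eval x ∂(ρ : Measure (Space d)) = ∫ x, ψ.eval x ∂(ρ : Measure (Space d)) := by
    refine le_antisymm ?_ (integral_mono (ψ.integrable_eval _) (w.integrable_eval _) h)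
    have h2 : (1 - (ρ.mass : ℝ)) * ψ.2 ≤ (1 - ρ.mass) * w.2 :=
      mul_le_mul_of_nonneg_left h' (by linarith)
    unfold dualValue Potential.atInfinity at hv
    linarith
  have h3 : ∀ᵐ x ∂(ρ : Measure (Space d)), w.eval x - ψ.eval x = 0 := by
    refine (integral_eq_zero_iff_of_nonneg (fun x => sub_nonneg.2 (h x))
      ((w.integrable_eval _).sub (ψ.integrable_eval _))).1 ?_
    rw [integral_sub (w.integrable_eval _) (ψ.integrable_eval _), h1, sub_self]
  intro x hx
  by_contra hne
  have hopen : IsOpen {z | w.eval z - ψ.eval z ≠ 0} :=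
    isOpen_ne_fun (w.continuous_eval.sub ψ.continuous_eval) continuous_const
  have hpos := (Measure.mem_support_iff_forall _).1 hx _
    (hopen.mem_nhds (sub_ne_zero.2 (Ne.symm hne)))
  exact hpos.ne' h3

/-! ### Existence of a Lipschitz optimal potential -/

/-- A uniformly bounded sequence of uniformly Lipschitz functions has a pointwise convergent
subsequence. -/
theorem exists_subseq_tendsto_of_lipschitz {α : Type*} [PseudoMetricSpace α]
    [TopologicalSpace.SeparableSpace α] [Nonempty α] {L : ℝ≥0} {a b : ℝ} {w : ℕ → α → ℝ}
    (hL : ∀ n, LipschitzWith L (w n)) (hw : ∀ n x, w n x ∈ Set.Icc a b) :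
    ∃ (u : α → ℝ) (φ : ℕ → ℕ), StrictMono φ ∧
      ∀ x, Tendsto (fun n => w (φ n) x) atTop (𝓝 (u x)) := by
  let q := TopologicalSpace.denseSeq α
  obtain ⟨l, -, φ, hφ, hl⟩ :=
    (isCompact_univ_pi fun _ : ℕ => isCompact_Icc (a := a) (b := b)).tendsto_subseq
    (x := fun n k => w n (q k)) (fun n k _ => hw n (q k))
  have hq : ∀ k, CauchySeq fun n => w (φ n) (q k) := fun k =>
    ((tendsto_pi_nhds.1 hl) k).cauchySeq
  have hx : ∀ x, ∃ y, Tendsto (fun n => w (φ n) x) atTop (𝓝 y) := by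
    intro x
    refine cauchySeq_tendsto_of_complete (Metric.cauchySeq_iff'.2 fun ε hε => ?_)
    have hη : 0 < ε / (3 * (L + 1)) := by positivity
    obtain ⟨k, hk⟩ := (TopologicalSpace.denseRange_denseSeq α).exists_dist_lt x hη
    have hLk : ∀ n, dist (w n x) (w n (q k)) < ε / 3 := by
      intro n
      rw [lt_div_iff₀ (by positivity)] at hk
      have h1 := (hL n).dist_le_mul x (q k)
      have h2 : 0 ≤ dist x (q k) := dist_nonneg
      by_cases h0 : dist x (q k) = 0
      · rw [h0, mul_zero] at h1
        linarith
      · have h3 : 0 < dist x (q k) := lt_of_le_of_ne h2 (Ne.symm h0)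
        change dist x (q k) * (3 * (L + 1)) < ε at hk
        linarith
    obtain ⟨n₀, hn₀⟩ := Metric.cauchySeq_iff'.1 (hq k) (ε / 3) (by positivity)
    refine ⟨n₀, fun n hn => ?_⟩
    have h1 := hLk (φ n)
    have h2 := hLk (φ n₀)
    have h3 := hn₀ n hn
    have h4 := dist_triangle4 (w (φ n) x) (w (φ n) (q k)) (w (φ n₀) (q k)) (w (φ n₀) x)
    rw [dist_comm (w (φ n₀) x)] at h2
    linarith
  choose u hu using hx
  exact ⟨u, φ, hφ, hu⟩

theorem exists_lipschitz_isOptimalPotential {d N : ℕ} (hd : 1 ≤ d) (hN : 1 ≤ N)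
    {ρ : FiniteMeasure (Space d)} (hρ : ρ.mass ≤ 1) {δ K : ℝ≥0} (hδ : 0 < δ)
    (hK : relaxedCost N ((1 + δ) • ρ) ≤ (K : ℝ≥0∞)) :
    ∃ u : Potential d, IsOptimalPotential N ρ u ∧
      LipschitzWith (lipschitzBound N (K / δ + 1)) u.eval := by
  have := cocompact_neBot hd
  set A : ℝ≥0 := K / δ + 1
  -- Only nonnegative dual values give the bound at infinity; the zero potential shows that the
  -- restriction costs nothing.
  let S : Set ℝ := dualValue ρ '' {ψ | ψ ∈ admissible d N ∧ 0 ≤ dualValue ρ ψ}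
  have hSbdd : BddAbove S := ⟨K / δ, by
    rintro _ ⟨ψ, hψ, rfl⟩
    exact dualValue_le_div hd hN hδ hK hψ.1⟩
  have hS0 : (0 : ℝ) ∈ S :=
    ⟨0, ⟨zero_mem_admissible d N, (dualValue_zero ρ).ge⟩, dualValue_zero ρ⟩
  obtain ⟨s, -, hs, hsS⟩ := exists_seq_tendsto_sSup ⟨0, hS0⟩ hSbdd
  choose ψ hψ hψs using hsS
  choose w hw1 hw2 hw3 hw4 hw5 hw6 hw7 using fun n =>
    exists_lipschitz_potential_ge_of_dualValue_nonneg hd hN hδ hK (hψ n).1 (hψ n).2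
  have hval : Tendsto (fun n => dualValue ρ (w n)) atTop (𝓝 (sSup S)) := by
    have hmono : ∀ n, s n ≤ dualValue ρ (w n) := fun n => by
      rw [← hψs n]
      exact dualValue_mono hρ (hw2 n) (hw3 n)
    refine tendsto_of_tendsto_of_tendsto_of_le_of_le hs tendsto_const_nhds hmono fun n => ?_
    exact le_csSup hSbdd ⟨w n, ⟨hw1 n, (hψ n).2.trans ((hψs n).le.trans (hmono n))⟩, rfl⟩
  have hIcc : ∀ n x, (w n).eval x ∈ Set.Icc (-(A : ℝ)) (N * A) := fun n x =>
    ⟨(hw5 n).trans (hw6 n x), hw7 n x⟩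
  obtain ⟨u, φ, hφ, hu⟩ := exists_subseq_tendsto_of_lipschitz hw4 hIcc
  obtain ⟨κ, -, θ, hθ, hκ⟩ := (isCompact_Icc (a := -(A : ℝ)) (b := N * A)).tendsto_subseq
    (x := fun n => (w (φ n)).2) (fun n => ⟨hw5 _, (hw6 _ 0).trans (hw7 _ 0)⟩)
  have hu' : ∀ x, Tendsto (fun n => (w (φ (θ n))).eval x) atTop (𝓝 (u x)) := fun x =>
    (hu x).comp hθ.tendsto_atTop
  have hκA : -(A : ℝ) ≤ κ := ge_of_tendsto' hκ fun n => hw5 _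
  -- Each regularized potential lies above its own value at infinity, and this survives the limit.
  -- It prevents a loss in the term carrying the missing mass.
  have hκu : ∀ x, κ ≤ u x := fun x => le_of_tendsto_of_tendsto' hκ (hu' x) fun n => hw6 _ x
  have huadm : IsAdmissible N u := fun x hx =>
    le_of_tendsto' (tendsto_finsetSum _ fun i _ => hu' (x i)) fun n =>
      (mem_admissible_iff hN).1 (hw1 _) x hx
  have hint : Tendsto (fun n => ∫ x, (w (φ (θ n))).eval x ∂(ρ : Measure (Space d))) atTop
      (𝓝 (∫ x, u x ∂(ρ : Measure (Space d)))) := by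
    refine tendsto_integral_of_dominated_convergence (fun _ => max (N * (A : ℝ)) A)
      (fun n => (w _).continuous_eval.aestronglyMeasurable) (integrable_const _)
      (fun n => Eventually.of_forall fun x => ?_) (Eventually.of_forall hu')
    rw [Real.norm_eq_abs, abs_le]
    exact ⟨(neg_le_neg (le_max_right _ _)).trans (hIcc _ x).1, (hIcc _ x).2.trans (le_max_left _ _)⟩
  have hlimval : ∫ x, u x ∂(ρ : Measure (Space d)) + (1 - (ρ.mass : ℝ)) * κ = sSup S :=
    tendsto_nhds_unique (hint.add (hκ.const_mul _))
      ((hval.comp hφ.tendsto_atTop).comp hθ.tendsto_atTop)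
  -- Pointwise convergence does not control behaviour at infinity, so `u` need not come from `C₀ ⊕
  -- ℝ`. A second regularization returns to that space with the same constant, since `u` is still at
  -- least `-A`.
  obtain ⟨v, hv1, hv2, hv3, -, -, -⟩ := exists_lipschitz_potential_ge hN huadm
    (Frequently.of_forall fun z => hκA.trans (hκu z))
  have hκv : κ ≤ v.2 := ge_of_tendsto' v.tendsto_eval fun x => (hκu x).trans (hv2 x)
  have huint : Integrable u (ρ : Measure (Space d)) := by
    refine Integrable.mono' (integrable_const (max (N * (A : ℝ)) A))
      (aestronglyMeasurable_of_tendsto_ae atTop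
        (fun n => (w (φ (θ n))).continuous_eval.aestronglyMeasurable)
        (Eventually.of_forall hu')) (Eventually.of_forall fun x => ?_)
    rw [Real.norm_eq_abs, abs_le]
    exact ⟨(neg_le_neg (le_max_right _ _)).trans (hκA.trans (hκu x)),
      (le_of_tendsto' (hu' x) fun n => (hIcc _ x).2).trans (le_max_left _ _)⟩
  have hρ' : (ρ.mass : ℝ) ≤ 1 := hρ
  have hvval : sSup S ≤ dualValue ρ v := by
    rw [← hlimval]
    exact add_le_add (integral_mono huint (v.integrable_eval _) hv2)
      (mul_le_mul_of_nonneg_left hκv (by linarith))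
  refine ⟨v, ⟨(mem_admissible_iff hN).2 hv1, fun ψ' hψ' => ?_⟩, hv3⟩
  change dualValue ρ ψ' ≤ dualValue ρ v
  by_cases h0 : 0 ≤ dualValue ρ ψ'
  · exact (le_csSup hSbdd ⟨ψ', ⟨hψ', h0⟩, rfl⟩).trans hvval
  · exact (not_le.1 h0).le.trans ((le_csSup hSbdd hS0).trans hvval)

theorem IsOptimalPotential.exists_lipschitz_eqOn_support {d N : ℕ} (hd : 1 ≤ d) (hN : 1 ≤ N)
    {ρ : FiniteMeasure (Space d)} (hρ : ρ.mass ≤ 1) {δ K : ℝ≥0} (hδ : 0 < δ)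
    (hK : relaxedCost N ((1 + δ) • ρ) ≤ (K : ℝ≥0∞)) {v : Potential d}
    (hv : IsOptimalPotential N ρ v) :
    ∃ w : Potential d, IsOptimalPotential N ρ w ∧
      LipschitzWith (lipschitzBound N (K / δ + 1)) w.eval ∧
      Set.EqOn v.eval w.eval (ρ : Measure (Space d)).support := by
  have h0 : 0 ≤ dualValue ρ v := by
    rw [← dualValue_zero ρ]
    exact hv.2 (zero_mem_admissible d N)
  obtain ⟨w, hw1, hw2, hw3, hw4, -, -, -⟩ :=
    exists_lipschitz_potential_ge_of_dualValue_nonneg hd hN hδ hK hv.1 h0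
  exact ⟨w, ⟨hw1, fun ψ hψ => (hv.2 hψ).trans (dualValue_mono hρ hw2 hw3)⟩, hw4,
    eqOn_support_of_dualValue_le hρ hw2 hw3 (hv.2 hw1)⟩

/-! ### Separability of `C₀` -/

/-- A continuous cutoff, equal to `1` on the ball of radius `R` and to `0` outside the ball of
radius `R + 1`. -/
noncomputable def cutoff {d : ℕ} (R : ℝ) (x : Space d) : ℝ := max 0 (min 1 (R + 1 - ‖x‖))

theorem continuous_cutoff {d : ℕ} (R : ℝ) : Continuous (cutoff (d := d) R) := by
  unfold cutoff; fun_prop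

theorem cutoff_of_le {d : ℕ} {R : ℝ} {x : Space d} (h : ‖x‖ ≤ R) : cutoff R x = 1 := by
  rw [cutoff, min_eq_left (by linarith), max_eq_right zero_le_one]

theorem cutoff_of_ge {d : ℕ} {R : ℝ} {x : Space d} (h : R + 1 ≤ ‖x‖) : cutoff R x = 0 := by
  rw [cutoff, max_eq_left]
  exact (min_le_right _ _).trans (by linarith)

theorem cutoff_nonneg {d : ℕ} (R : ℝ) (x : Space d) : 0 ≤ cutoff R x := le_max_left _ _

theorem cutoff_le_one {d : ℕ} (R : ℝ) (x : Space d) : cutoff R x ≤ 1 :=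
  max_le zero_le_one (min_le_left _ _)

/-- The truncation of a continuous function, as a function vanishing at infinity. -/
noncomputable def truncate {d : ℕ} (R : ℝ) (g : C(Space d, ℝ)) : C₀(Space d, ℝ) :=
  ⟨⟨fun x => cutoff R x * g x, (continuous_cutoff R).mul g.continuous⟩, by
    refine tendsto_const_nhds.congr' ?_
    filter_upwards [(tendsto_norm_cocompact_atTop (E := Space d)).eventually_ge_atTop (R + 1)]
      with x hx
    simp [cutoff_of_ge hx]⟩

/-- Integer-radius truncations of a sequence dense for the compact-open topology suffice: the radius
is chosen so that `φ` is small where the cutoff differs from `1`, and the approximation is made on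
the ball carrying the cutoff. -/
theorem exists_seq_zeroAtInfty_dense (d : ℕ) : ∃ q : ℕ → C₀(Space d, ℝ),
    ∀ (φ : C₀(Space d, ℝ)) (ε : ℝ), 0 < ε → ∃ k, ∀ x, |φ x - q k x| ≤ ε := by
  let g := TopologicalSpace.denseSeq C(Space d, ℝ)
  refine ⟨fun k => truncate (k.unpair.1 : ℝ) (g k.unpair.2), fun φ ε hε => ?_⟩
  have h1 : ∀ᶠ x in cocompact (Space d), |φ x| < ε / 2 := by
    have := (zero_at_infty φ).abs
    rw [abs_zero] at this
    exact this.eventually_lt_const (half_pos hε)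
  rw [← Metric.cobounded_eq_cocompact, ← comap_norm_atTop] at h1
  obtain ⟨r, hr⟩ := (eventually_comap.1 h1).exists_forall_of_atTop
  obtain ⟨R, hR⟩ := exists_nat_ge r
  have h2 : ∀ᶠ f in 𝓝 (φ : C(Space d, ℝ)), ∀ x ∈ Metric.closedBall (0 : Space d) (R + 1),
      dist (φ x) (f x) < ε / 2 :=
    (Metric.tendstoUniformlyOn_iff.1
      (ContinuousMap.tendsto_iff_forall_isCompact_tendstoUniformlyOn.1
      tendsto_id _ (isCompact_closedBall (0 : Space d) ((R : ℝ) + 1)))) _ (half_pos hε)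
  obtain ⟨_, hf, m, rfl⟩ := (mem_closure_iff_nhds.1
    ((TopologicalSpace.denseRange_denseSeq C(Space d, ℝ)) (φ : C(Space d, ℝ)))) _ h2
  refine ⟨Nat.pair R m, fun x => ?_⟩
  simp only [Nat.unpair_pair]
  change |φ x - cutoff R x * g m x| ≤ ε
  by_cases hx : ‖x‖ ≤ R + 1
  · have h3 := hf x (by simpa using hx)
    change |φ x - g m x| < ε / 2 at h3
    have h4 : (1 - cutoff R x) * |φ x| ≤ ε / 2 := by
      by_cases hx' : ‖x‖ ≤ R
      · rw [cutoff_of_le hx']; linarith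
      · have := hr ‖x‖ (by linarith) x rfl
        have h0 := cutoff_nonneg R x
        have h5 := cutoff_le_one R x
        nlinarith [abs_nonneg (φ x)]
    have h5 : φ x - cutoff R x * g m x
        = (1 - cutoff R x) * φ x + cutoff R x * (φ x - g m x) := by ring
    have h6 : cutoff R x * |φ x - g m x| ≤ 1 * |φ x - g m x| :=
      mul_le_mul_of_nonneg_right (cutoff_le_one R x) (abs_nonneg _)
    calc |φ x - cutoff R x * g m x|
        ≤ |(1 - cutoff R x) * φ x| + |cutoff R x * (φ x - g m x)| := by
          rw [h5]; exact abs_add_le _ _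
      _ = (1 - cutoff R x) * |φ x| + cutoff R x * |φ x - g m x| := by
          rw [abs_mul, abs_mul, abs_of_nonneg (cutoff_nonneg R x),
            abs_of_nonneg (sub_nonneg.2 (cutoff_le_one R x))]
      _ ≤ ε := by linarith
  · rw [cutoff_of_ge (by linarith), zero_mul, sub_zero]
    exact (hr ‖x‖ (by linarith) x rfl).le.trans (by linarith)

theorem abs_integral_sub_le {d : ℕ} {φ φ' : C₀(Space d, ℝ)} {ε : ℝ} (h : ∀ x, |φ x - φ' x| ≤ ε)
    (μ : Measure (Space d)) [IsFiniteMeasure μ] (hμ : μ.real Set.univ ≤ 1) (hε : 0 ≤ ε) :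
    |∫ x, φ x ∂μ - ∫ x, φ' x ∂μ| ≤ ε := by
  rw [← integral_sub (integrable_zeroAtInfty _ _) (integrable_zeroAtInfty _ _)]
  have := norm_integral_le_of_norm_le_const (μ := μ) (f := fun x => φ x - φ' x)
    (Eventually.of_forall h)
  exact this.trans (mul_le_of_le_one_right hε hμ)

/-- Weak* convergence can be tested on a uniformly dense sequence. -/
theorem weakStarTendsto_of_dense {d : ℕ} {q : ℕ → C₀(Space d, ℝ)}
    (hq : ∀ (φ : C₀(Space d, ℝ)) (ε : ℝ), 0 < ε → ∃ k, ∀ x, |φ x - q k x| ≤ ε)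
    {ρs : ℕ → ProbabilityMeasure (Space d)} {ρ : FiniteMeasure (Space d)} (hρ : ρ.mass ≤ 1)
    (h : ∀ k, Tendsto (fun n => ∫ x, q k x ∂(ρs n : Measure (Space d))) atTop
      (𝓝 (∫ x, q k x ∂(ρ : Measure (Space d))))) :
    WeakStarTendsto ρs ρ := by
  intro φ
  rw [Metric.tendsto_atTop]
  intro ε hε
  have hε4 : 0 < ε / 4 := by positivity
  obtain ⟨k, hk⟩ := hq φ (ε / 4) hε4
  obtain ⟨n₀, hn₀⟩ := Metric.tendsto_atTop.1 (h k) (ε / 4) hε4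
  refine ⟨n₀, fun n hn => ?_⟩
  have h1 := abs_integral_sub_le hk (ρs n : Measure (Space d)) (by simp) hε4.le
  have h2 := abs_integral_sub_le hk (ρ : Measure (Space d)) hρ hε4.le
  have h3 := hn₀ n hn
  rw [Real.dist_eq] at h3 ⊢
  rw [abs_lt] at h3 ⊢
  rw [abs_le] at h1 h2
  constructor <;> linarith [h1.1, h1.2, h2.1, h2.2, h3.1, h3.2]

/-! ### Absence of a duality gap -/

/-- The pairing of the algebraic dual of `C₀` with `C₀`. -/
noncomputable abbrev pairing (d : ℕ) :
    Module.Dual ℝ C₀(Space d, ℝ) →ₗ[ℝ] C₀(Space d, ℝ) →ₗ[ℝ] ℝ := LinearMap.id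

/-- Integration against a finite measure as a linear form on `C₀`. -/
noncomputable def integralForm {d : ℕ} (μ : Measure (Space d)) [IsFiniteMeasure μ] :
    WeakBilin (pairing d) :=
  ({ toFun := fun φ => ∫ x, φ x ∂μ
     map_add' := fun φ φ' =>
      integral_add (integrable_zeroAtInfty φ μ) (integrable_zeroAtInfty φ' μ)
     map_smul' := fun c φ => integral_const_mul c φ } : Module.Dual ℝ C₀(Space d, ℝ))

/-- The pairs formed by a probability measure, seen as a linear form on `C₀`, and a bound for the
cost of one of its transport plans. -/
def costEpigraph (d N : ℕ) : Set (WeakBilin (pairing d) × ℝ) :=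
  {p | 0 ≤ p.2 ∧ ∃ ρ : ProbabilityMeasure (Space d), p.1 = integralForm (ρ : Measure (Space d)) ∧
    ∃ P ∈ plans N ρ, ∫⁻ x, coulomb x ∂(P : Measure (Fin N → Space d)) ≤ ENNReal.ofReal p.2}

/-- A convex combination of two probability measures. -/
noncomputable def mix {α : Type*} [MeasurableSpace α] (a b : ℝ≥0) (hab : a + b = 1)
    (μ ν : ProbabilityMeasure α) : ProbabilityMeasure α :=
  ⟨a • (μ : Measure α) + b • (ν : Measure α), ⟨by
    rw [Measure.add_apply, Measure.coe_nnreal_smul_apply, Measure.coe_nnreal_smul_apply,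
      measure_univ, measure_univ, mul_one, mul_one, ← ENNReal.coe_add, hab, ENNReal.coe_one]⟩⟩

theorem toMeasure_mix {α : Type*} [MeasurableSpace α] (a b : ℝ≥0) (hab : a + b = 1)
    (μ ν : ProbabilityMeasure α) :
    (mix a b hab μ ν : Measure α) = a • (μ : Measure α) + b • (ν : Measure α) := rfl

theorem convex_costEpigraph (d N : ℕ) : Convex ℝ (costEpigraph d N) := by
  rintro ⟨Λ, t⟩ ⟨ht, ρ, rfl, P, hP, hPt⟩ ⟨Λ', t'⟩ ⟨ht', ρ', rfl, P', hP', hPt'⟩ a b ha hb hab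
  lift a to ℝ≥0 using ha
  lift b to ℝ≥0 using hb
  have hab' : a + b = 1 := by exact_mod_cast hab
  simp only at ht ht' hPt hPt'
  refine ⟨?_, mix a b hab' ρ ρ', ?_, mix a b hab' P P', ?_, ?_⟩
  · simp only [Prod.snd_add, Prod.smul_snd, smul_eq_mul]
    positivity
  · refine LinearMap.ext fun φ => ?_
    change a * ∫ x, φ x ∂(ρ : Measure (Space d)) + b * ∫ x, φ x ∂(ρ' : Measure (Space d))
      = ∫ x, φ x ∂(mix a b hab' ρ ρ' : Measure (Space d))
    rw [toMeasure_mix, integral_add_measure (integrable_zeroAtInfty _ _)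
      (integrable_zeroAtInfty _ _), integral_smul_nnreal_measure, integral_smul_nnreal_measure]
    rfl
  · intro i
    rw [toMeasure_mix, toMeasure_mix, Measure.map_add _ _ (measurable_pi_apply i),
      Measure.map_smul, Measure.map_smul, hP i, hP' i]
  · rw [toMeasure_mix, lintegral_add_measure, lintegral_smul_measure, lintegral_smul_measure]
    simp only [Prod.snd_add, Prod.smul_snd, smul_eq_mul]
    rw [ENNReal.ofReal_add (by positivity) (by positivity),
      ENNReal.ofReal_mul (NNReal.coe_nonneg a),
      ENNReal.ofReal_mul (NNReal.coe_nonneg b), ENNReal.ofReal_coe_nnreal,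
      ENNReal.ofReal_coe_nnreal]
    exact add_le_add (mul_le_mul_right hPt _) (mul_le_mul_right hPt' _)

/-- The uniform measure on a nonempty finite family of points. -/
noncomputable def uniformDirac {α : Type*} [MeasurableSpace α] {N : ℕ} [NeZero N]
    (x : Fin N → α) : ProbabilityMeasure α :=
  ⟨(N : ℝ≥0)⁻¹ • ∑ i, Measure.dirac (x i), ⟨by
    have hN : (N : ℝ≥0∞) ≠ 0 := by simpa using NeZero.ne N
    simpa [ENNReal.smul_def, ENNReal.coe_inv (NeZero.ne (N : ℝ≥0))]
      using ENNReal.inv_mul_cancel hN (ENNReal.natCast_ne_top N)⟩⟩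

theorem toMeasure_uniformDirac {α : Type*} [MeasurableSpace α] {N : ℕ} [NeZero N]
    (x : Fin N → α) : (uniformDirac x : Measure α) = (N : ℝ≥0)⁻¹ • ∑ i, Measure.dirac (x i) := rfl

/-- The average of the cyclic permutations of a configuration is a transport plan. -/
theorem uniformDirac_mem_plans {d N : ℕ} [NeZero N] (x : Fin N → Space d) :
    uniformDirac (fun s : Fin N => x ∘ Equiv.addRight s) ∈ plans N (uniformDirac x) := by
  intro i
  rw [toMeasure_uniformDirac, toMeasure_uniformDirac, Measure.map_smul,
    Measure.map_finset_sum (measurable_pi_apply i).aemeasurable]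
  simp only [Measure.map_dirac' (measurable_pi_apply i)]
  congr 1
  exact Equiv.sum_comp (Equiv.addLeft i) fun j => Measure.dirac (x j)

theorem integral_uniformDirac {d N : ℕ} [NeZero N] (x : Fin N → Space d) (φ : C₀(Space d, ℝ)) :
    ∫ z, φ z ∂(uniformDirac x : Measure (Space d)) = (N : ℝ)⁻¹ * ∑ i, φ (x i) := by
  rw [toMeasure_uniformDirac, integral_smul_nnreal_measure,
    integral_finsetSum_measure fun i _ => integrable_zeroAtInfty _ _]
  simp [NNReal.smul_def]

/-- Cyclic shifts have the same energy, so their average is a plan of cost `energy x`. These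
elements alone recover the pointwise constraint from the separating functional. -/
theorem mem_costEpigraph_of_injective {d N : ℕ} [NeZero N] {x : Fin N → Space d}
    (hx : Function.Injective x) {t : ℝ} (ht : energy x ≤ t) :
    (integralForm (uniformDirac x : Measure (Space d)), t) ∈ costEpigraph d N := by
  refine ⟨(energy_nonneg x).trans ht, uniformDirac x, rfl, _, uniformDirac_mem_plans x, ?_⟩
  rw [toMeasure_uniformDirac, lintegral_smul_measure, lintegral_finsetSum_measure]
  have : ∀ s : Fin N, ∫⁻ z, coulomb z ∂(Measure.dirac (x ∘ Equiv.addRight s))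
      = ENNReal.ofReal (energy x) := fun s => by
    rw [lintegral_dirac, coulomb_of_injective (hx.comp (Equiv.injective _)), energy_comp_equiv]
  simp only [this]
  rw [Finset.sum_const, Finset.card_univ, Fintype.card_fin, nsmul_eq_mul, ENNReal.smul_def,
    smul_eq_mul, ENNReal.coe_inv (NeZero.ne (N : ℝ≥0)), ENNReal.coe_natCast, ← mul_assoc,
    ENNReal.inv_mul_cancel (by simpa using NeZero.ne N) (ENNReal.natCast_ne_top N), one_mul]
  exact ENNReal.ofReal_le_ofReal ht

/-- A finite measure together with an upper bound for its dual values belongs to the weak closure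
of the cost epigraph. -/
theorem mem_closure_costEpigraph {d N : ℕ} [NeZero N] (hd : 1 ≤ d)
    {ρ : FiniteMeasure (Space d)} {a : ℝ} (ha : 0 ≤ a)
    (hdual : ∀ ψ ∈ admissible d N, dualValue ρ ψ ≤ a) :
    (integralForm (ρ : Measure (Space d)), a) ∈ closure (costEpigraph d N) := by
  have hN : 1 ≤ N := NeZero.one_le
  have := cocompact_neBot hd
  by_contra hcon
  obtain ⟨f, s, hfs, hsf⟩ := geometric_hahn_banach_closed_point
    (convex_costEpigraph d N).closure isClosed_closure hcon
  -- For the weak topology induced by the pairing, continuous functionals are evaluations, so the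
  -- first component of `f` is a genuine element of `C₀`.
  obtain ⟨φ, hφ⟩ := LinearMap.dualEmbedding_surjective (pairing d)
    (f.comp (ContinuousLinearMap.inl ℝ (WeakBilin (pairing d)) ℝ))
  set μ : ℝ := f (0, 1) with hμ
  have hf : ∀ (ν : Measure (Space d)) [IsFiniteMeasure ν] (t : ℝ),
      f (integralForm ν, t) = ∫ x, φ x ∂ν + t * μ := by
    intro ν _ t
    have h1 : (integralForm ν, t)
        = (integralForm ν, (0 : ℝ)) + t • ((0 : WeakBilin (pairing d)), (1 : ℝ)) := by
      simp
    have h2 : f (integralForm ν, (0 : ℝ)) = ∫ x, φ x ∂ν :=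
      (DFunLike.congr_fun hφ (integralForm ν)).symm
    rw [h1, map_add, map_smul, h2, smul_eq_mul]
  have hpt : ∀ x : Fin N → Space d, Function.Injective x → ∀ t, energy x ≤ t →
      (N : ℝ)⁻¹ * ∑ i, φ (x i) + t * μ < s := by
    intro x hx t ht
    have h1 := hfs _ (subset_closure (mem_costEpigraph_of_injective hx ht))
    rwa [hf, integral_uniformDirac] at h1
  rw [hf] at hsf
  -- The epigraph is unbounded in the cost direction, so a positive slope would violate the
  -- separation.
  have hμ0 : μ ≤ 0 := by
    by_contra! hpos
    obtain ⟨x, hx, -⟩ := exists_spread_configuration (N := N) (p := fun _ : Space d => True)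
      (Frequently.of_forall fun _ => trivial) 0 ⟨0, hN⟩ one_pos
    have h1 := hpt x hx (max (energy x) ((s - (N : ℝ)⁻¹ * ∑ i, φ (x i)) / μ)) (le_max_left _ _)
    have h2 := mul_le_mul_of_nonneg_right
      (le_max_right (energy x) ((s - (N : ℝ)⁻¹ * ∑ i, φ (x i)) / μ)) hpos.le
    rw [div_mul_cancel₀ _ hpos.ne'] at h2
    linarith
  have hN' : (0 : ℝ) < N := by exact_mod_cast hN
  set V : ℝ := ∫ x, φ x ∂(ρ : Measure (Space d)) - s with hV
  have hVa : a * (-μ) < V := by linarith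
  -- By `hpt`, the potential `k (φ - s)` is admissible as soon as `k * (-μ) ≤ 1`, and its dual value
  -- is `k * V`.
  have key : ∀ k : ℝ, 0 ≤ k → k * (-μ) ≤ 1 → k * V ≤ a := by
    intro k hk hkμ
    have h1 : dualValue ρ (k • ((φ, -s) : Potential d)) = k * V := by
      rw [dualValue_eq]
      change ∫ x, k * φ x ∂(ρ : Measure (Space d)) + k * (-s) = k * V
      rw [integral_const_mul]
      ring
    rw [← h1]
    refine hdual _ ((mem_admissible_iff hN).2 fun x hx => ?_)
    have h2 := hpt x hx _ le_rfl
    have h3 : ∑ i, Potential.eval (k • ((φ, -s) : Potential d)) (x i)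
        = k * (∑ i, φ (x i) - N * s) := by
      change ∑ i, (k * φ (x i) + k * (-s)) = _
      rw [Finset.sum_add_distrib, ← Finset.mul_sum, Finset.sum_const, Finset.card_univ,
        Fintype.card_fin, nsmul_eq_mul]
      ring
    have h4 : ∑ i, φ (x i) - N * s ≤ N * (energy x * (-μ)) := by
      have h5 := mul_le_mul_of_nonneg_left h2.le hN'.le
      rw [mul_add, mul_inv_cancel_left₀ hN'.ne'] at h5
      linarith
    rw [h3]
    calc k * (∑ i, φ (x i) - N * s) ≤ k * (N * (energy x * (-μ))) :=
          mul_le_mul_of_nonneg_left h4 hk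
      _ = (k * (-μ)) * (N * energy x) := by ring
      _ ≤ 1 * (N * energy x) :=
          mul_le_mul_of_nonneg_right hkμ (mul_nonneg hN'.le (energy_nonneg x))
      _ = N * energy x := one_mul _
  -- A vertical separation (`μ = 0`) leaves `k` unconstrained with `V > 0`, so the dual values would
  -- be unbounded. Otherwise `k = (-μ)⁻¹` contradicts `a * (-μ) < V`.
  rcases hμ0.eq_or_lt with h0 | hneg
  · rw [h0, neg_zero, mul_zero] at hVa
    have h1 := key ((a + 1) / V) (by positivity) (by rw [h0]; simp)
    rw [div_mul_cancel₀ _ hVa.ne'] at h1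
    linarith
  · have hpos : 0 < -μ := by linarith
    have h1 := key (-μ)⁻¹ (by positivity) (inv_mul_cancel₀ hpos.ne').le
    rw [inv_mul_le_iff₀ hpos] at h1
    linarith

/-- Absence of a duality gap: an upper bound for the dual problem bounds the relaxed cost. -/
theorem relaxedCost_le_ofReal {d N : ℕ} (hd : 1 ≤ d) (hN : 1 ≤ N)
    {ρ : FiniteMeasure (Space d)} (hρ : ρ.mass ≤ 1) {a : ℝ} (ha : 0 ≤ a)
    (hdual : ∀ ψ ∈ admissible d N, dualValue ρ ψ ≤ a) :
    relaxedCost N ρ ≤ ENNReal.ofReal a := by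
  have : NeZero N := ⟨by omega⟩
  have hmem := mem_closure_costEpigraph hd ha hdual
  obtain ⟨q, hq⟩ := exists_seq_zeroAtInfty_dense d
  -- A weak neighbourhood controls only finitely many test functions, so the `n`-th measure is
  -- tested on the first `n` members of the dense sequence.
  have hex : ∀ n : ℕ, ∃ ρ' : ProbabilityMeasure (Space d),
      (∀ k < n, |∫ x, q k x ∂(ρ' : Measure (Space d)) - ∫ x, q k x ∂(ρ : Measure (Space d))|
        < 1 / ((n : ℝ) + 1)) ∧
      transportCost N ρ' ≤ ENNReal.ofReal (a + 1 / ((n : ℝ) + 1)) := by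
    intro n
    have hn : (0 : ℝ) < 1 / ((n : ℝ) + 1) := Nat.one_div_pos_of_nat
    have h1 : ∀ᶠ p : WeakBilin (pairing d) × ℝ in 𝓝 (integralForm (ρ : Measure (Space d)), a),
        ∀ k ∈ Finset.range n,
          |pairing d p.1 (q k) - ∫ x, q k x ∂(ρ : Measure (Space d))| < 1 / ((n : ℝ) + 1) := by
      refine (eventually_all_finset _).2 fun k _ => ?_
      have hc : Continuous fun p : WeakBilin (pairing d) × ℝ =>
          |pairing d p.1 (q k) - ∫ x, q k x ∂(ρ : Measure (Space d))| :=
        (((WeakBilin.eval_continuous (pairing d) (q k)).comp continuous_fst).sub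
          continuous_const).abs
      refine hc.continuousAt.eventually_lt_const ?_
      change |∫ x, q k x ∂(ρ : Measure (Space d)) - ∫ x, q k x ∂(ρ : Measure (Space d))| < _
      rw [sub_self, abs_zero]
      exact hn
    have h2 : ∀ᶠ p : WeakBilin (pairing d) × ℝ in 𝓝 (integralForm (ρ : Measure (Space d)), a),
        p.2 < a + 1 / ((n : ℝ) + 1) :=
      continuous_snd.continuousAt.eventually_lt_const (by simpa using hn)
    obtain ⟨p, ⟨hp1, hp2⟩, -, ρ', hpρ, P, hP, hPt⟩ :=
      mem_closure_iff_nhds.1 hmem _ (h1.and h2)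
    refine ⟨ρ', fun k hk => ?_, (iInf₂_le P hP).trans (hPt.trans (ENNReal.ofReal_le_ofReal hp2.le))⟩
    have := hp1 k (Finset.mem_range.2 hk)
    rwa [hpρ] at this
  choose ρs hρs hcost using hex
  have hlim : Tendsto (fun n : ℕ => 1 / ((n : ℝ) + 1)) atTop (𝓝 0) :=
    tendsto_one_div_add_atTop_nhds_zero_nat
  have hweak : WeakStarTendsto ρs ρ := by
    refine weakStarTendsto_of_dense hq hρ fun k => tendsto_iff_dist_tendsto_zero.2 ?_
    refine squeeze_zero' (Eventually.of_forall fun n => dist_nonneg) ?_ hlim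
    filter_upwards [eventually_gt_atTop k] with n hn
    exact (hρs n k hn).le
  have hlim' : Tendsto (fun n : ℕ => ENNReal.ofReal (a + 1 / ((n : ℝ) + 1))) atTop
      (𝓝 (ENNReal.ofReal a)) := by
    have h := (ENNReal.continuous_ofReal.tendsto (a + 0)).comp (hlim.const_add a)
    rwa [add_zero] at h
  calc relaxedCost N ρ ≤ liminf (fun n => transportCost N (ρs n)) atTop := iInf₂_le ρs hweak
    _ ≤ liminf (fun n : ℕ => ENNReal.ofReal (a + 1 / ((n : ℝ) + 1))) atTop :=
        liminf_le_liminf (Eventually.of_forall hcost)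
    _ = ENNReal.ofReal a := hlim'.liminf_eq

/-- Duality: an optimal potential attains the relaxed cost. -/
theorem IsOptimalPotential.dualValue_eq_relaxedCost {d N : ℕ} (hd : 1 ≤ d) (hN : 1 ≤ N)
    {ρ : FiniteMeasure (Space d)} (hρ : ρ.mass ≤ 1) {u : Potential d}
    (hu : IsOptimalPotential N ρ u) :
    ((dualValue ρ u : ℝ) : EReal) = (relaxedCost N ρ : EReal) := by
  have h0 : 0 ≤ dualValue ρ u := by
    rw [← dualValue_zero ρ]
    exact hu.2 (zero_mem_admissible d N)
  rw [le_antisymm (relaxedCost_le_ofReal hd hN hρ h0 fun ψ hψ => hu.2 hψ)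
    (ofReal_dualValue_le_relaxedCost hN ρ hu.1), EReal.coe_ennreal_ofReal, max_eq_left h0]

end RelaxedCoulomb

theorem mainTheorem3 (N : ℕ) (hN : 1 ≤ N) :
    ∃ γ : ℝ≥0 → ℝ≥0 → ℝ≥0,
      ∀ (d : ℕ), 1 ≤ d →
      ∀ (ρ : FiniteMeasure (RelaxedCoulomb.Space d)), ρ.mass < 1 →
      ∀ (δ K : ℝ≥0), 0 < δ → RelaxedCoulomb.relaxedCost N ((1 + δ) • ρ) ≤ (K : ℝ≥0∞) →
        (∃ u : RelaxedCoulomb.Potential d,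
          RelaxedCoulomb.IsOptimalPotential N ρ u ∧
          ((RelaxedCoulomb.dualValue ρ u : ℝ) : EReal)
            = (RelaxedCoulomb.relaxedCost N ρ : EReal) ∧
          LipschitzWith (γ δ K) (RelaxedCoulomb.Potential.eval u)) ∧
        (∀ v : RelaxedCoulomb.Potential d, RelaxedCoulomb.IsOptimalPotential N ρ v →
          ∃ w : RelaxedCoulomb.Potential d,
            RelaxedCoulomb.IsOptimalPotential N ρ w ∧
            LipschitzWith (γ δ K) (RelaxedCoulomb.Potential.eval w) ∧
            Set.EqOn (RelaxedCoulomb.Potential.eval v) (RelaxedCoulomb.Potential.eval w)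
              (ρ : Measure (RelaxedCoulomb.Space d)).support) := by
  refine ⟨fun δ K => RelaxedCoulomb.lipschitzBound N (K / δ + 1),
    fun d hd ρ hρ δ K hδ hK => ⟨?_, fun v hv =>
      hv.exists_lipschitz_eqOn_support hd hN hρ.le hδ hK⟩⟩
  obtain ⟨u, hu, hlip⟩ :=
    RelaxedCoulomb.exists_lipschitz_isOptimalPotential hd hN hρ.le hδ hK
  exact ⟨u, hu, hu.dualValue_eq_relaxedCost hd hN hρ.le, hlip⟩
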